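/- Let $\Gamma$ be a finite $n$-player normal-form game: each player $i\in\{1,\dots,n\}$ has a finite nonempty action set $A^i$ and a reward function $r^i:A^1\times\cdots\times A^n\to\mathbb{R}$. A mixed strategy of player $i$ is a probability vector $x^i$ on $A^i$; for a profile $\mathbf{x}=(x^1,\dots,x^n)$ of mixed strategies let $$R^i(\mathbf{x})=\sum_{a\in A^1\times\cdots\times A^n} r^i(a)\prod_{j=1}^n x^j(a^j)$$ be the expected reward of player $i$ when the players draw their actions independently. Player $i$ is satisfied at $\mathbf{x}$ if $x^i$ is a best response to $\mathbf{x}^{-i}$, that is, $R^i(x^i,\mathbf{x}^{-i})\ge R^i(y^i,\mathbf{x}^{-i})$ for every mixed strategy $y^i$ of player $i$; otherwise $i$ is unsatisfied at $\mathbf{x}$. A (mixed) Nash equilibrium is a profile at which all players are satisfied. A sequence of profiles $\mathbf{x}_0,\mathbf{x}_1,\dots$ is a satisficing path if, for all consecutive $\mathbf{x}_t,\mathbf{x}_{t+1}$ and every player $i$ who is satisfied at $\mathbf{x}_t$, one has $x^i_{t+1}=x^i_t$. Then $\Gamma$ has the satisficing paths property: for every initial profile $\mathbf{x}_0$ there is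 a finite satisficing path $\mathbf{x}_0,\dots,\mathbf{x}_T$ such that $\mathbf{x}_T$ is a Nash equilibrium. Moreover, the path can be chosen with at most $n$ steps, $T\le n$, and such that in every step except the last one the set of unsatisfied players strictly grows: $\mathrm{UnSat}(\mathbf{x}_t)\subsetneq\mathrm{UnSat}(\mathbf{x}_{t+1})$ whenever $t+1<T$. -/

import Mathlib

universe u

/-- A finite `n`-player normal-form game: every player `i` has a finite nonempty action set
`Action i` and a reward function on the set of action profiles. -/
structure NormalFormGame (n : ℕ) where
  /-- The action set of each player. -/
  Action : Fin n → Type u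
  [fintypeAction : ∀ i, Fintype (Action i)]
  [nonemptyAction : ∀ i, Nonempty (Action i)]
  /-- The reward of each player, as a function of the action profile. -/
  reward : Fin n → (∀ i, Action i) → ℝ

namespace NormalFormGame

attribute [instance] NormalFormGame.fintypeAction NormalFormGame.nonemptyAction

variable {n : ℕ} (Γ : NormalFormGame.{u} n)

/-- The mixed strategies of player `i`: probability vectors on the action set of `i`. -/
abbrev Strategy (i : Fin n) : Type u := stdSimplex ℝ (Γ.Action i)

/-- Mixed-strategy profiles. -/
abbrev Profile : Type u := ∀ i, Γ.Strategy i

/-- The expected reward of player `i` when all players draw their actions independently, player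
`j` with distribution `x j`. -/
noncomputable def expectedReward (i : Fin n) (x : Γ.Profile) : ℝ :=
  ∑ a : (∀ j, Γ.Action j), (∏ j, (x j : Γ.Action j → ℝ) (a j)) * Γ.reward i a

/-- The set of best responses of player `i` to the strategies of the other players in `x`.
(The component `x i` plays no role: it is overwritten on both sides.) -/
def bestResponses (i : Fin n) (x : Γ.Profile) : Set (Γ.Strategy i) :=
  {s | ∀ y : Γ.Strategy i,
    Γ.expectedReward i (Function.update x i y) ≤ Γ.expectedReward i (Function.update x i s)}

/-- A mixed Nash equilibrium: every player best responds to the others. -/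
def IsNashEquilibrium (x : Γ.Profile) : Prop :=
  ∀ i, x i ∈ Γ.bestResponses i x

/-- The set of unsatisfied players at `x`: those who are not best responding. -/
def unsatisfied (x : Γ.Profile) : Set (Fin n) :=
  {i | x i ∉ Γ.bestResponses i x}

/-- The sequence `x 0, x 1, …` with `T` steps, `T ∈ ℕ ∪ {∞}` (so `x 0, …, x T` if `T` is finite;
the later values of `x` are then ignored), is a satisficing path: a player who is best responding
at time `t` keeps its strategy at time `t + 1`. -/
def IsSatisficingPath (T : ℕ∞) (x : ℕ → Γ.Profile) : Prop :=
  ∀ t : ℕ, (t : ℕ∞) < T → ∀ i, x t i ∈ Γ.bestResponses i (x t) → x (t + 1) i = x t i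

/-- The satisficing paths property: from every initial profile, some satisficing path ends at a
Nash equilibrium after finitely many steps. -/
def HasSatisficingPathsProperty : Prop :=
  ∀ x₁ : Γ.Profile, ∃ (T : ℕ) (x : ℕ → Γ.Profile),
    Γ.IsSatisficingPath T x ∧ x 0 = x₁ ∧ Γ.IsNashEquilibrium (x T)

end NormalFormGame

/-! Every step but the last enlarges the set of unsatisfied players, so the work lies in one step,
`exists_step`. Let the players unsatisfied at `x` move and freeze the others; Nash's theorem for the
movers gives `z`. If `z` is not an equilibrium, some frozen player is unsatisfied at `z`, hence also
nearby. Join `z` to `x` by a polynomial path along which the movers are fully mixed strictly between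
the ends. Each mover's action rewards are not all equal at `x`, so by analyticity they are not all
equal just after `z`, and a fully mixed strategy is then no best response. Such a point keeps every
mover unsatisfied and adds a player.

Nash's theorem comes from logit equilibria as the intensity tends to infinity. These are fixed
points of a smooth map, so Brouwer's theorem is needed only for `C¹` maps; it follows from a
volume-polynomial proof that no `C¹` retraction onto the sphere exists. -/

section Brouwer

/-! ### Brouwer's theorem for `C¹` maps. -/

open Set Metric MeasureTheory Filter Topology

variable {E : Type*} [NormedAddCommGroup E]

/-- The degree bound does not depend on `A`, so the same interpolation nodes will serve at every
point of the ball. -/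
theorem LinearMap.exists_polynomial_eval_eq_det_one_add_smul [NormedSpace ℝ E]
    [FiniteDimensional ℝ E] (A : E →ₗ[ℝ] E) :
    ∃ p : Polynomial ℝ, p.natDegree ≤ Module.finrank ℝ E ∧
      ∀ t : ℝ, p.eval t = LinearMap.det (1 + t • A) := by
  classical
  let b := Module.finBasis ℝ E
  let M := LinearMap.toMatrix b b A
  refine ⟨((Polynomial.X : Polynomial ℝ) • M.map Polynomial.C +
    (1 : Matrix _ _ ℝ).map Polynomial.C).det, ?_, fun t => ?_⟩
  · simpa using Polynomial.natDegree_det_X_add_C_le M 1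
  · rw [← LinearMap.det_toMatrix b, ← Polynomial.coe_evalRingHom, RingHom.map_det]
    congr 1
    ext i j
    by_cases hij : i = j
    · simp [M, LinearMap.toMatrix_one, hij]
      ring
    · simp [M, LinearMap.toMatrix_one, hij]
      ring

/-- The image is open by the inverse function theorem and relatively closed by compactness, since
boundary points stay on the boundary; the ball is connected. -/
theorem image_ball_eq_ball [NormedSpace ℝ E] [FiniteDimensional ℝ E] {R : ℝ} (hR : 0 < R)
    {h : E → E} {h' : E → E →L[ℝ] E} (hmap : ∀ x, ‖x‖ ≤ R → ‖h x‖ ≤ R)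
    (hid : ∀ x, ‖x‖ = R → h x = x) (hinj : InjOn h (closedBall 0 R))
    (hc : ContinuousOn h (closedBall 0 R))
    (hd : ∀ x ∈ ball 0 R, HasStrictFDerivAt h (h' x) x) (hu : ∀ x ∈ ball 0 R, IsUnit (h' x)) :
    h '' ball 0 R = ball 0 R := by
  have hsub : h '' ball 0 R ⊆ ball 0 R := by
    rintro _ ⟨x, hx, rfl⟩
    rw [mem_ball_zero_iff] at hx ⊢
    refine lt_of_le_of_ne (hmap x hx.le) fun hn => ?_
    have := hinj (by simpa using hn.le) (by simpa using hx.le) (hid _ hn)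
    rw [this] at hn
    exact hx.ne hn
  refine hsub.antisymm ?_
  refine (convex_ball (0 : E) R).isPreconnected.subset_of_closure_inter_subset ?_ ?_ ?_
  · rw [isOpen_iff_mem_nhds]
    rintro _ ⟨x, hx, rfl⟩
    obtain ⟨e, he⟩ := hu x hx
    have hd' : HasStrictFDerivAt h (ContinuousLinearEquiv.ofUnit e : E →L[ℝ] E) x := by
      have := hd x hx
      rwa [← he] at this
    rw [← hd'.map_nhds_eq_of_equiv]
    exact image_mem_map (isOpen_ball.mem_nhds hx)
  · exact ⟨h 0, hsub ⟨0, by simpa, rfl⟩, ⟨0, by simpa, rfl⟩⟩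
  · have hcl : IsClosed (h '' closedBall 0 R) :=
      ((isCompact_closedBall (0 : E) R).image_of_continuousOn hc).isClosed
    rintro y ⟨hy, hyb⟩
    obtain ⟨x, hx, rfl⟩ := closure_minimal (image_mono ball_subset_closedBall) hcl hy
    rw [mem_closedBall_zero_iff] at hx
    rw [mem_ball_zero_iff] at hyb
    refine ⟨x, ?_, rfl⟩
    rw [mem_ball_zero_iff]
    refine lt_of_le_of_ne hx fun hn => ?_
    rw [hid x hn] at hyb
    exact hyb.ne hn

theorem isUnit_one_add_smul [NormedSpace ℝ E] [FiniteDimensional ℝ E] {A : E →L[ℝ] E} {C t : ℝ}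
    (hA : ‖A‖ ≤ C) (ht : 0 ≤ t) (htC : t * C < 1) : IsUnit (1 + t • A) := by
  have : ‖-(t • A)‖ < 1 := by
    rw [norm_neg, norm_smul, Real.norm_of_nonneg ht]
    exact (mul_le_mul_of_nonneg_left hA ht).trans_lt htC
  simpa using isUnit_one_sub_of_norm_lt_one this

theorem ContinuousLinearMap.det_ne_zero_of_isUnit [NormedSpace ℝ E] [FiniteDimensional ℝ E]
    {A : E →L[ℝ] E} (h : IsUnit A) : A.det ≠ 0 := by
  obtain ⟨u, rfl⟩ := h
  have h1 : (u : E →L[ℝ] E).det * (↑u⁻¹ : E →L[ℝ] E).det = 1 := by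
    rw [ContinuousLinearMap.det, ContinuousLinearMap.det, ← map_mul]
    have : ((u : E →L[ℝ] E) : E →ₗ[ℝ] E) * ((↑u⁻¹ : E →L[ℝ] E) : E →ₗ[ℝ] E) = 1 := by
      rw [← ContinuousLinearMap.toLinearMap_mul, u.mul_inv]; rfl
    rw [this, map_one]
  exact left_ne_zero_of_mul_eq_one h1

theorem det_one_add_smul_pos [NormedSpace ℝ E] [FiniteDimensional ℝ E] {A : E →L[ℝ] E} {C t : ℝ}
    (hA : ‖A‖ ≤ C) (ht : 0 ≤ t) (htC : t * C < 1) : 0 < (1 + t • A).det := by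
  by_contra! hneg
  have hcont : ContinuousOn (fun s : ℝ => (1 + s • A).det) (Icc 0 t) :=
    (ContinuousLinearMap.continuous_det.comp (by fun_prop)).continuousOn
  have h0 : (1 + (0 : ℝ) • A).det = 1 := by simp [ContinuousLinearMap.det]
  obtain ⟨s, hs, hs0⟩ := intermediate_value_Icc' ht hcont ⟨hneg, h0 ▸ zero_le_one⟩
  have hC : 0 ≤ C := (norm_nonneg A).trans hA
  exact ContinuousLinearMap.det_ne_zero_of_isUnit
    (isUnit_one_add_smul hA hs.1 ((mul_le_mul_of_nonneg_right hs.2 hC).trans_lt htC)) hs0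

/-- Differentiating `‖f‖² = R²` shows that the range of `f'` is orthogonal to `f x ≠ 0`. -/
theorem det_fderiv_eq_zero_of_norm_eq [InnerProductSpace ℝ E] [FiniteDimensional ℝ E] {R : ℝ}
    (hR : 0 < R) {f : E → E} {f' : E →L[ℝ] E} {x : E} (hf : HasFDerivAt f f' x)
    (hn : ∀ᶠ y in 𝓝 x, ‖f y‖ = R) : f'.det = 0 := by
  by_contra hdet
  have hsurj : Function.Surjective f' := by
    have : IsUnit (f' : E →ₗ[ℝ] E) := (LinearMap.isUnit_iff_isUnit_det _).mpr (Ne.isUnit hdet)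
    exact ((Module.End.isUnit_iff _).mp this).2
  obtain ⟨v, hv⟩ := hsurj (f x)
  have h1 := hf.norm_sq
  have h2 : HasFDerivAt (fun y => ‖f y‖ ^ 2) (0 : E →L[ℝ] ℝ) x := by
    refine (hasFDerivAt_const (R ^ 2) x).congr_of_eventuallyEq ?_
    filter_upwards [hn] with y hy
    rw [hy]
  have h3 := congrArg (fun L : E →L[ℝ] ℝ => L v) (h1.unique h2)
  simp only [zero_apply, smul_apply,
    ContinuousLinearMap.comp_apply, innerSL_apply_apply, hv, real_inner_self_eq_norm_sq] at h3
  have h4 := hn.self_of_nhds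
  rw [h4] at h3
  have : (0:ℝ) < R ^ 2 := by positivity
  simp at h3
  exact hR.ne' h3

/-- There is no `C¹` retraction of a ball onto its bounding sphere. -/
theorem no_contDiffAt_retraction [InnerProductSpace ℝ E] [FiniteDimensional ℝ E] {R : ℝ}
    (hR : 0 < R) {f : E → E} (hf : ∀ x ∈ closedBall 0 R, ContDiffAt ℝ 1 f x)
    (hS : ∀ x ∈ closedBall 0 R, ‖f x‖ = R) (hid : ∀ x, ‖x‖ = R → f x = x) : False := by
  borelize E
  let μ : Measure E := Measure.addHaar
  have hBconv := convex_closedBall (0 : E) R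
  have hBcomp := isCompact_closedBall (0 : E) R
  let A : E → E →L[ℝ] E := fun x => fderiv ℝ f x - 1
  have hfd : ∀ x ∈ closedBall 0 R, HasStrictFDerivAt f (fderiv ℝ f x) x :=
    fun x hx => (hf x hx).hasStrictFDerivAt one_ne_zero
  have hgd : ∀ x ∈ closedBall 0 R, HasStrictFDerivAt (fun y => f y - y) (A x) x :=
    fun x hx => (hfd x hx).sub (hasStrictFDerivAt_id x)
  have hAc : ContinuousOn A (closedBall 0 R) := fun x hx =>
    (((hf x hx).continuousAt_fderiv one_ne_zero).sub continuousAt_const).continuousWithinAt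
  obtain ⟨C, hC⟩ := hBcomp.exists_bound_of_continuousOn hAc
  have hC0 : 0 ≤ C := (norm_nonneg _).trans (hC 0 (by simpa using hR.le))
  have hLip : ∀ x ∈ closedBall 0 R, ∀ y ∈ closedBall 0 R,
      ‖(f y - y) - (f x - x)‖ ≤ C * ‖y - x‖ := fun x hx y hy =>
    hBconv.norm_image_sub_le_of_norm_hasFDerivWithin_le
      (fun z hz => (hgd z hz).hasFDerivAt.hasFDerivWithinAt) hC hx hy
  -- For small `t` this is a bijection of the open ball, so its Jacobian integrates to the volume of
  -- the ball.
  let h : ℝ → E → E := fun t x => x + t • (f x - x)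
  have hhd : ∀ t, ∀ x ∈ closedBall 0 R, HasStrictFDerivAt (h t) (1 + t • A x) x :=
    fun t x hx => (hasStrictFDerivAt_id x).add ((hgd x hx).const_smul t)
  have hinj : ∀ t, 0 ≤ t → t * C < 1 → InjOn (h t) (closedBall 0 R) := by
    intro t ht htC x hx y hy hxy
    have e : y - x = -(t • ((f y - y) - (f x - x))) := by
      simp only [h] at hxy
      have : y - x + t • ((f y - y) - (f x - x)) = 0 := by
        rw [smul_sub, ← sub_eq_zero.mpr hxy.symm]; abel
      exact eq_neg_of_add_eq_zero_left this
    have e2 : ‖y - x‖ ≤ t * C * ‖y - x‖ := by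
      calc ‖y - x‖ = t * ‖(f y - y) - (f x - x)‖ := by
            conv_lhs => rw [e]
            rw [norm_neg, norm_smul, Real.norm_of_nonneg ht]
        _ ≤ t * (C * ‖y - x‖) := by gcongr; exact hLip x hx y hy
        _ = _ := by ring
    have e3 : ‖y - x‖ = 0 := by nlinarith [norm_nonneg (y - x)]
    exact (sub_eq_zero.mp (norm_eq_zero.mp e3)).symm
  have himage : ∀ t, 0 ≤ t → t ≤ 1 → t * C < 1 → h t '' ball 0 R = ball 0 R := by
    intro t ht ht1 htC
    refine image_ball_eq_ball hR (h' := fun x => 1 + t • A x) ?_ ?_ (hinj t ht htC)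
      (fun x hx => (hhd t x hx).continuousAt.continuousWithinAt)
      (fun x hx => hhd t x (ball_subset_closedBall hx))
      (fun x hx => isUnit_one_add_smul (hC x (ball_subset_closedBall hx)) ht htC)
    · intro x hx
      have hfx := hS x (by simpa using hx)
      have : h t x = (1 - t) • x + t • f x := by simp only [h]; module
      rw [← mem_closedBall_zero_iff, this]
      exact hBconv (by simpa using hx) (by simpa using hfx.le) (by linarith) ht (by ring)
    · intro x hx
      simp [h, hid x hx]
  have hvol : ∀ t, 0 ≤ t → t ≤ 1 → t * C < 1 →
      IntegrableOn (fun x => (1 + t • A x).det) (ball 0 R) μ ∧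
        ∫ x in ball 0 R, (1 + t • A x).det ∂μ = μ.real (ball 0 R) := by
    intro t ht ht1 htC
    have hd : ∀ x ∈ ball 0 R, HasFDerivWithinAt (h t) (1 + t • A x) (ball 0 R) x :=
      fun x hx => (hhd t x (ball_subset_closedBall hx)).hasFDerivAt.hasFDerivWithinAt
    have hi := (hinj t ht htC).mono ball_subset_closedBall
    have hpos : ∀ x ∈ ball 0 R, |(1 + t • A x).det| • (1 : ℝ) = (1 + t • A x).det := by
      intro x hx
      rw [abs_of_pos (det_one_add_smul_pos (hC x (ball_subset_closedBall hx)) ht htC), smul_eq_mul,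
        mul_one]
    constructor
    · have := (integrableOn_image_iff_integrableOn_abs_det_fderiv_smul μ measurableSet_ball hd hi
        (fun _ => (1 : ℝ))).mp (by
          rw [himage t ht ht1 htC]
          exact integrableOn_const measure_ball_lt_top.ne)
      exact this.congr_fun hpos measurableSet_ball
    · have := integral_image_eq_integral_abs_det_fderiv_smul μ measurableSet_ball hd hi
        (fun _ => (1 : ℝ))
      rw [himage t ht ht1 htC, setIntegral_congr_fun measurableSet_ball hpos] at this
      rw [← this]
      simp
  let d := Module.finrank ℝ E
  -- The `d + 1` nodes `k / N` are small enough for `hvol`; Lagrange extrapolation then carries the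
  -- Jacobian to `t = 1`, where it vanishes.
  let N : ℝ := (d + 1) * (C + 1)
  have hN : 0 < N := by positivity
  let v : ℕ → ℝ := fun k => k / N
  let s := Finset.range (d + 1)
  have hvinj : InjOn v s := by
    intro i _ j _ hij
    simpa [v, div_left_inj' hN.ne'] using hij
  have hv : ∀ k ∈ s, 0 ≤ v k ∧ v k ≤ 1 ∧ v k * C < 1 := by
    intro k hk
    have hk' : (k : ℝ) + 1 ≤ d + 1 := by
      exact_mod_cast Finset.mem_range.mp hk
    have hk0 : (0 : ℝ) ≤ k := k.cast_nonneg
    refine ⟨by positivity, ?_, ?_⟩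
    · rw [div_le_one hN]
      simp only [N]; nlinarith
    · simp only [v]
      rw [div_mul_eq_mul_div, div_lt_one hN]
      simp only [N]; nlinarith
  let L : ℕ → ℝ := fun k => (Lagrange.basis s v k).eval 1
  have hLsum : ∑ k ∈ s, L k = 1 := by
    have := congrArg (Polynomial.eval 1) (Lagrange.sum_basis hvinj ⟨0, by simp [s]⟩)
    simpa [Polynomial.eval_finsetSum] using this
  have hdet : ∀ x ∈ ball 0 R, ∑ k ∈ s, L k * (1 + v k • A x).det = 0 := by
    intro x hx
    obtain ⟨p, hp, hpe⟩ := (A x : E →ₗ[ℝ] E).exists_polynomial_eval_eq_det_one_add_smul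
    have hpi := Lagrange.eq_interpolate (f := p) hvinj
      (lt_of_le_of_lt Polynomial.degree_le_natDegree
        (by simpa [s] using Nat.cast_lt.mpr (Nat.lt_succ_of_le hp)))
    have h1 := congrArg (Polynomial.eval 1) hpi
    rw [Lagrange.interpolate_apply, Polynomial.eval_finsetSum] at h1
    have h2 : p.eval 1 = 0 := by
      rw [hpe, one_smul]
      have : (1 + (A x : E →ₗ[ℝ] E)) = (fderiv ℝ f x : E →ₗ[ℝ] E) := by
        ext y; simp [A]
      rw [this]
      refine det_fderiv_eq_zero_of_norm_eq hR (hfd x (ball_subset_closedBall hx)).hasFDerivAt ?_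
      filter_upwards [isOpen_ball.mem_nhds hx] with y hy using hS y (ball_subset_closedBall hy)
    rw [← h2, h1]
    refine Finset.sum_congr rfl fun k _ => ?_
    rw [Polynomial.eval_mul, Polynomial.eval_C, hpe, mul_comm]
    rfl
  have hint : ∫ x in ball 0 R, ∑ k ∈ s, L k * (1 + v k • A x).det ∂μ = μ.real (ball 0 R) := by
    rw [integral_finsetSum _ fun k hk =>
      ((hvol (v k) (hv k hk).1 (hv k hk).2.1 (hv k hk).2.2).1.const_mul (L k))]
    rw [Finset.sum_congr rfl fun k hk => by
      rw [integral_const_mul, (hvol (v k) (hv k hk).1 (hv k hk).2.1 (hv k hk).2.2).2]]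
    rw [← Finset.sum_mul, hLsum, one_mul]
  rw [setIntegral_congr_fun measurableSet_ball hdet, integral_zero] at hint
  exact (measure_ball_pos μ 0 hR).ne'
    ((measureReal_eq_zero_iff measure_ball_lt_top.ne).mp hint.symm)

/-- **Brouwer's fixed point theorem** for `C¹` maps sending a ball into its interior. -/
theorem exists_fixedPoint_of_contDiff [InnerProductSpace ℝ E] [FiniteDimensional ℝ E] {R : ℝ}
    (hR : 0 < R) {f : E → E} (hf : ContDiff ℝ 1 f) (hb : ∀ x, ‖f x‖ < R) : ∃ x, f x = x := by
  by_contra! hne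
  let w : E → E := fun x => x - f x
  have hw : ∀ x, 0 < ‖w x‖ ^ 2 := fun x =>
    pow_pos (norm_pos_iff.mpr (sub_ne_zero.mpr (hne x).symm)) 2
  have hwc : ContDiff ℝ 1 w := contDiff_id.sub hf
  -- A quarter of the discriminant of `‖x + s • w x‖² = R²` as a quadratic in `s`. The larger root
  -- gives the exit point of the ray from `f x` through `x`, and is `0` on the sphere.
  let D : E → ℝ := fun x => inner ℝ x (w x) ^ 2 + ‖w x‖ ^ 2 * (R ^ 2 - ‖x‖ ^ 2)
  have hDc : ContDiff ℝ 1 D :=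
    ((contDiff_id.inner ℝ hwc).pow 2).add
      ((hwc.norm_sq ℝ).mul (contDiff_const.sub (contDiff_id.norm_sq ℝ)))
  have hbd : ∀ x, ‖x‖ = R → 0 < inner ℝ x (w x) := by
    intro x hx
    have h1 := real_inner_le_norm x (f x)
    have h2 := hb x
    simp only [w, inner_sub_right, real_inner_self_eq_norm_sq]
    rw [hx] at h1 ⊢
    nlinarith
  have hDpos : ∀ x ∈ closedBall 0 R, 0 < D x := by
    intro x hx
    rw [mem_closedBall_zero_iff] at hx
    rcases hx.lt_or_eq with hx | hx
    · have : 0 < R ^ 2 - ‖x‖ ^ 2 := by nlinarith [norm_nonneg x]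
      have := mul_pos (hw x) this
      simp only [D]; positivity
    · have := hbd x hx
      simp only [D, hx, sub_self, mul_zero, add_zero]
      positivity
  let s : E → ℝ := fun x => (√(D x) - inner ℝ x (w x)) / ‖w x‖ ^ 2
  refine no_contDiffAt_retraction hR (f := fun x => x + s x • w x) ?_ ?_ ?_
  · intro x hx
    have hs : ContDiffAt ℝ 1 s x :=
      ((hDc.contDiffAt.sqrt (hDpos x hx).ne').sub (contDiff_id.inner ℝ hwc).contDiffAt).div
        (hwc.norm_sq ℝ).contDiffAt (hw x).ne'
    exact contDiffAt_id.add (hs.smul hwc.contDiffAt)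
  · intro x hx
    have hsq := Real.sq_sqrt (hDpos x hx).le
    have : ‖x + s x • w x‖ ^ 2 = R ^ 2 := by
      rw [norm_add_sq_real, inner_smul_right, norm_smul, mul_pow, Real.norm_eq_abs, sq_abs]
      have hw' := hw x
      have hsw : s x * ‖w x‖ ^ 2 = √(D x) - inner ℝ x (w x) := div_mul_cancel₀ _ hw'.ne'
      have : ‖w x‖ ^ 2 *
          (‖x‖ ^ 2 + 2 * (s x * inner ℝ x (w x)) + s x ^ 2 * ‖w x‖ ^ 2 - R ^ 2) = 0 := by
        have e : ‖w x‖ ^ 2 *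
            (‖x‖ ^ 2 + 2 * (s x * inner ℝ x (w x)) + s x ^ 2 * ‖w x‖ ^ 2 - R ^ 2)
          = ‖w x‖ ^ 2 * (‖x‖ ^ 2 - R ^ 2) + 2 * (s x * ‖w x‖ ^ 2) * inner ℝ x (w x)
            + (s x * ‖w x‖ ^ 2) ^ 2 := by ring
        rw [e, hsw]
        have hD : D x = inner ℝ x (w x) ^ 2 + ‖w x‖ ^ 2 * (R ^ 2 - ‖x‖ ^ 2) := rfl
        linear_combination hsq + hD
      linarith [(mul_eq_zero.mp this).resolve_left hw'.ne']
    exact (pow_left_inj₀ (norm_nonneg _) hR.le two_ne_zero).mp this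
  · intro x hx
    have h1 := hbd x hx
    have : s x = 0 := by
      simp only [s, D, hx, sub_self, mul_zero, add_zero]
      rw [Real.sqrt_sq h1.le, sub_self, zero_div]
    simp [this]

end Brouwer

/-! ### Best responses in terms of pure-action rewards. -/

namespace NormalFormGame

open Filter Topology

variable {n : ℕ} (Γ : NormalFormGame.{u} n)

open Classical in
/-- The expected reward of player `i` for the pure action `b`, as a polynomial in the (not
necessarily stochastic) weights `y` of the other players. -/
noncomputable def actionReward (i : Fin n) (b : Γ.Action i) (y : ∀ j, Γ.Action j → ℝ) : ℝ :=
  ∑ a : (∀ j, Γ.Action j),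
    (if a i = b then 1 else 0) * (∏ j ∈ Finset.univ.erase i, y j (a j)) * Γ.reward i a

/-- The mixing weights of a profile. -/
abbrev weights (x : Γ.Profile) : ∀ j, Γ.Action j → ℝ := fun j => x j

variable {Γ}

theorem continuous_actionReward (i : Fin n) (b : Γ.Action i) :
    Continuous (Γ.actionReward i b) := by
  unfold actionReward
  fun_prop

theorem continuous_weights : Continuous Γ.weights :=
  continuous_pi fun j => continuous_subtype_val.comp (continuous_apply j)

theorem expectedReward_update (i : Fin n) (x : Γ.Profile) (s : Γ.Strategy i) :
    Γ.expectedReward i (Function.update x i s) =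
      ∑ c, s c * Γ.actionReward i c (Γ.weights x) := by
  classical
  simp only [expectedReward, actionReward, Finset.mul_sum]
  rw [Finset.sum_comm]
  refine Finset.sum_congr rfl fun a _ => ?_
  rw [← Finset.mul_prod_erase Finset.univ _ (Finset.mem_univ i), Function.update_self,
    Finset.prod_congr rfl fun j hj => by rw [Function.update_of_ne (Finset.ne_of_mem_erase hj)]]
  rw [Finset.sum_eq_single (a i)]
  · simp
    ring
  · intro c _ hc
    simp [hc.symm]
  · simp

/-- The expected reward is linear in a player's own strategy, so pure deviations suffice. -/
theorem mem_bestResponses_iff {i : Fin n} {x : Γ.Profile} {s : Γ.Strategy i} :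
    s ∈ Γ.bestResponses i x ↔ ∀ b, Γ.actionReward i b (Γ.weights x) ≤
      ∑ c, s c * Γ.actionReward i c (Γ.weights x) := by
  classical
  constructor
  · intro h b
    have := h ⟨Pi.single b 1, single_mem_stdSimplex ℝ b⟩
    rw [expectedReward_update, expectedReward_update] at this
    refine le_trans (le_of_eq ?_) this
    change _ = ∑ c, (Pi.single b 1 : Γ.Action i → ℝ) c * _
    simp [Pi.single_apply]
  · intro h y
    rw [expectedReward_update, expectedReward_update]
    calc _ ≤ ∑ b, y b * ∑ c, s c * Γ.actionReward i c (Γ.weights x) :=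
          Finset.sum_le_sum fun b _ => mul_le_mul_of_nonneg_left (h b) (y.2.1 b)
      _ = _ := by
          rw [← Finset.sum_mul]
          have : ∑ b, y b = 1 := y.2.2
          rw [this, one_mul]

theorem exists_actionReward_ne_of_notMem_bestResponses {i : Fin n} {x : Γ.Profile}
    {s : Γ.Strategy i} (h : s ∉ Γ.bestResponses i x) :
    ∃ b c, Γ.actionReward i b (Γ.weights x) ≠ Γ.actionReward i c (Γ.weights x) := by
  by_contra! heq
  refine h (mem_bestResponses_iff.mpr fun b => ?_)
  have h1 : ∑ c, s c = 1 := s.2.2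
  rw [Finset.sum_congr rfl fun c _ => by rw [heq c b], ← Finset.sum_mul, h1, one_mul]

theorem mem_bestResponses_of_support {i : Fin n} {x : Γ.Profile} {s : Γ.Strategy i}
    (h : ∀ c, s c ≠ 0 → ∀ b, Γ.actionReward i b (Γ.weights x) ≤
      Γ.actionReward i c (Γ.weights x)) : s ∈ Γ.bestResponses i x := by
  refine mem_bestResponses_iff.mpr fun b => ?_
  have h1 : ∑ c, s c = 1 := s.2.2
  calc Γ.actionReward i b (Γ.weights x) = ∑ c, s c * Γ.actionReward i b (Γ.weights x) := by
        rw [← Finset.sum_mul, h1, one_mul]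
    _ ≤ _ := Finset.sum_le_sum fun c _ => by
        by_cases hc : s c = 0
        · simp [hc]
        · exact mul_le_mul_of_nonneg_left (h c hc b) (s.2.1 c)

theorem notMem_bestResponses_of_pos {i : Fin n} {x : Γ.Profile} {s : Γ.Strategy i}
    (hpos : ∀ c, 0 < s c) {b c : Γ.Action i}
    (hlt : Γ.actionReward i b (Γ.weights x) < Γ.actionReward i c (Γ.weights x)) :
    s ∉ Γ.bestResponses i x := by
  intro hs
  rw [mem_bestResponses_iff] at hs
  obtain ⟨m, -, hm⟩ := Finset.univ.exists_max_image
    (fun c => Γ.actionReward i c (Γ.weights x)) ⟨b, Finset.mem_univ b⟩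
  have h1 : ∑ c, s c = 1 := s.2.2
  have : ∑ c, s c * Γ.actionReward i c (Γ.weights x) <
      ∑ c, s c * Γ.actionReward i m (Γ.weights x) :=
    Finset.sum_lt_sum (fun d hd => mul_le_mul_of_nonneg_left (hm d hd) (s.2.1 d))
      ⟨b, Finset.mem_univ b,
        mul_lt_mul_of_pos_left (hlt.trans_le (hm c (Finset.mem_univ c))) (hpos b)⟩
  rw [← Finset.sum_mul, h1, one_mul] at this
  exact absurd (hs m) (not_le.mpr this)

/-! ### Logit equilibria and Nash's theorem. -/

variable (Γ) in
/-- The logit response of player `i` with intensity `k` to the weights `y`. -/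
noncomputable def logit (k : ℝ) (i : Fin n) (y : ∀ j, Γ.Action j → ℝ) (a : Γ.Action i) : ℝ :=
  Real.exp (k * Γ.actionReward i a y) / ∑ c, Real.exp (k * Γ.actionReward i c y)

theorem sum_exp_pos (k : ℝ) (i : Fin n) (y : ∀ j, Γ.Action j → ℝ) :
    0 < ∑ c, Real.exp (k * Γ.actionReward i c y) :=
  Finset.sum_pos (fun _ _ => Real.exp_pos _) Finset.univ_nonempty

theorem logit_mem_stdSimplex (k : ℝ) (i : Fin n) (y : ∀ j, Γ.Action j → ℝ) :
    Γ.logit k i y ∈ stdSimplex ℝ (Γ.Action i) := by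
  refine ⟨fun a => div_nonneg (Real.exp_pos _).le (sum_exp_pos k i y).le, ?_⟩
  simp only [logit]
  rw [← Finset.sum_div, div_self (sum_exp_pos k i y).ne']

/-- Makes the weight of an action worse than `b` decay exponentially in `k`. -/
theorem logit_le_exp (k : ℝ) (i : Fin n) (y : ∀ j, Γ.Action j → ℝ) (b c : Γ.Action i) :
    Γ.logit k i y c ≤ Real.exp (k * (Γ.actionReward i c y - Γ.actionReward i b y)) := by
  rw [mul_sub, Real.exp_sub, logit]
  gcongr
  exact Finset.single_le_sum (f := fun c => Real.exp (k * Γ.actionReward i c y))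
    (fun _ _ => (Real.exp_pos _).le) (Finset.mem_univ b)

/-- Logit equilibria exist, even if the strategies of the players outside `S` are prescribed. -/
theorem exists_logit_equilibrium (k : ℝ) (S : Set (Fin n)) (x : Γ.Profile) :
    ∃ z : Γ.Profile, (∀ j ∉ S, z j = x j) ∧
      ∀ i ∈ S, ∀ a, z i a = Γ.logit k i (Γ.weights z) a := by
  classical
  let raw : EuclideanSpace ℝ (Σ i, Γ.Action i) → ∀ j, Γ.Action j → ℝ := fun y j a => y ⟨j, a⟩
  let G : EuclideanSpace ℝ (Σ i, Γ.Action i) → ∀ j, Γ.Action j → ℝ := fun y j =>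
    if j ∈ S then Γ.logit k j (raw y) else x j
  have hG : ∀ y j, G y j ∈ stdSimplex ℝ (Γ.Action j) := by
    intro y j
    by_cases hj : j ∈ S
    · simpa [G, hj] using logit_mem_stdSimplex k j (raw y)
    · have : G y j = x j := by simp [G, hj]
      exact this ▸ (x j).2
  let F : EuclideanSpace ℝ (Σ i, Γ.Action i) → EuclideanSpace ℝ (Σ i, Γ.Action i) :=
    fun y => WithLp.toLp 2 fun p => G y p.1 p.2
  have hraw : ∀ i b, ContDiff ℝ 1 fun y => Γ.actionReward i b (raw y) := by
    intro i b
    unfold actionReward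
    fun_prop
  have hF : ContDiff ℝ 1 F := by
    rw [contDiff_euclidean]
    rintro ⟨i, a⟩
    by_cases hi : i ∈ S
    · have : (fun y => F y ⟨i, a⟩) = fun y => Γ.logit k i (raw y) a := by
        ext y; simp [F, G, hi]
      rw [this]
      exact (contDiff_const.mul (hraw i a)).exp.div
        (ContDiff.sum fun c _ => (contDiff_const.mul (hraw i c)).exp)
        fun y => (sum_exp_pos k i (raw y)).ne'
    · have : (fun y => F y ⟨i, a⟩) = fun y => x i a := by
        ext y; simp [F, G, hi]
      rw [this]
      exact contDiff_const
  -- `F` is defined for arbitrary weights but takes values in `[0, 1]` coordinatewise, so its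
  -- squared norm is at most the number of coordinates.
  obtain ⟨y, hy⟩ := exists_fixedPoint_of_contDiff
    (R := Fintype.card (Σ i, Γ.Action i) + 1) (by positivity) hF fun y => by
      have h1 : ‖F y‖ ^ 2 ≤ Fintype.card (Σ i, Γ.Action i) := by
        rw [EuclideanSpace.norm_sq_eq, ← nsmul_one, ← Finset.card_univ]
        refine Finset.sum_le_card_nsmul _ _ _ fun p _ => ?_
        have hp := hG y p.1
        have h0 := hp.1 p.2
        have hle := mem_Icc_of_mem_stdSimplex hp p.2
        exact pow_le_one₀ (norm_nonneg _) (by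
          change ‖G y p.1 p.2‖ ≤ 1
          rw [Real.norm_of_nonneg h0]; exact hle.2)
      nlinarith [norm_nonneg (F y)]
  have hraw_eq : raw y = G y := by
    funext j a
    exact (congrFun (congrArg WithLp.ofLp hy) ⟨j, a⟩).symm
  refine ⟨fun j => ⟨G y j, hG y j⟩, fun j hj => ?_, fun i hi a => ?_⟩
  · exact Subtype.ext (if_neg hj)
  · change G y i a = Γ.logit k i (G y) a
    conv_lhs => simp only [G, hi, if_true]
    rw [hraw_eq]

/-- **Nash's theorem**, relative to prescribed strategies for the players outside `S`. -/
theorem exists_mem_bestResponses (S : Set (Fin n)) (x : Γ.Profile) :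
    ∃ z : Γ.Profile, (∀ j ∉ S, z j = x j) ∧ ∀ i ∈ S, z i ∈ Γ.bestResponses i z := by
  choose z hzx hz using fun k : ℕ => exists_logit_equilibrium (Γ := Γ) k S x
  have : ∀ i, CompactSpace (Γ.Strategy i) := fun i =>
    isCompact_iff_compactSpace.mp (isCompact_stdSimplex ℝ _)
  obtain ⟨w, φ, hφ, hw⟩ := CompactSpace.tendsto_subseq z
  have hweights : Tendsto (fun k => Γ.weights (z (φ k))) atTop (𝓝 (Γ.weights w)) :=
    (continuous_weights.tendsto w).comp hw
  refine ⟨w, fun j hj => ?_, fun i hi => mem_bestResponses_of_support fun c hc b => ?_⟩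
  · refine tendsto_nhds_unique ((continuous_apply j).tendsto w |>.comp hw) ?_
    simp only [Function.comp_def, hzx _ j hj, tendsto_const_nhds]
  -- If `b` beats `c` in the limit, the gap exceeds some `ε` along the subsequence, and the logit
  -- weight of `c` tends to `0`.
  · by_contra! hlt
    obtain ⟨ε, hε, hlt⟩ : ∃ ε > 0, Γ.actionReward i c (Γ.weights w) -
        Γ.actionReward i b (Γ.weights w) < -ε :=
      ⟨(Γ.actionReward i b (Γ.weights w) - Γ.actionReward i c (Γ.weights w)) / 2,
        by linarith, by linarith⟩
    have hev := ((((continuous_actionReward i c).sub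
      (continuous_actionReward i b)).tendsto (Γ.weights w)).comp hweights).eventually_lt_const hlt
    have hcoord : Tendsto (fun k => z (φ k) i c) atTop (𝓝 (w i c)) :=
      tendsto_pi_nhds.mp (tendsto_pi_nhds.mp hweights i) c
    have hexp : Tendsto (fun k => Real.exp ((φ k : ℝ) * -ε)) atTop (𝓝 0) :=
      Real.tendsto_exp_atBot.comp
        ((tendsto_natCast_atTop_atTop.comp hφ.tendsto_atTop).atTop_mul_const_of_neg
          (neg_lt_zero.mpr hε))
    refine hc (le_antisymm (le_of_tendsto_of_tendsto hcoord hexp ?_) ((w i).2.1 c))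
    filter_upwards [hev] with k hk
    rw [hz (φ k) i hi c]
    refine (logit_le_exp _ i _ b c).trans ?_
    gcongr
    exact hk.le

/-! ### The growth step and the satisficing path. -/

theorem eventually_ne_zero_of_analyticOnNhd {f : ℝ → ℝ} (hf : AnalyticOnNhd ℝ f Set.univ) {s : ℝ}
    (hs : f s ≠ 0) (t : ℝ) : ∀ᶠ r in 𝓝[≠] t, f r ≠ 0 := by
  by_contra h
  rw [not_eventually] at h
  simp only [not_not] at h
  exact hs (hf.eqOn_zero_of_preconnected_of_frequently_eq_zero isPreconnected_univ
    (Set.mem_univ t) h (Set.mem_univ s))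

/-- From any profile, the unsatisfied players can either reach an equilibrium in one step, or move
so that they all stay unsatisfied and some other player becomes unsatisfied. -/
theorem exists_step (x : Γ.Profile) : ∃ x' : Γ.Profile,
    (∀ j, x j ∈ Γ.bestResponses j x → x' j = x j) ∧
      (Γ.IsNashEquilibrium x' ∨ Γ.unsatisfied x ⊂ Γ.unsatisfied x') := by
  classical
  obtain ⟨z, hzx, hz⟩ := exists_mem_bestResponses (Γ.unsatisfied x) x
  have hsat : ∀ j, x j ∈ Γ.bestResponses j x → j ∉ Γ.unsatisfied x := fun j hj h => h hj
  by_cases hN : Γ.IsNashEquilibrium z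
  · exact ⟨z, fun j hj => hzx j (hsat j hj), Or.inl hN⟩
  obtain ⟨m, hm⟩ := not_forall.mp hN
  have hmU : m ∉ Γ.unsatisfied x := fun h => hm (hz m h)
  -- The coefficients sum to `1`; the uniform strategy in the middle term gives full support for `0
  -- < t < 1`.
  let W : ℝ → ∀ j, Γ.Action j → ℝ := fun t j a =>
    if j ∈ Γ.unsatisfied x then
      (1 - t) ^ 2 * z j a + t * (1 - t) * (Fintype.card (Γ.Action j) : ℝ)⁻¹ + t * x j a
    else z j a
  have hW0 : W 0 = Γ.weights z := by
    funext j a; simp [W]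
  have hW1 : W 1 = Γ.weights x := by
    funext j a
    by_cases hj : j ∈ Γ.unsatisfied x
    · simp [W, hj]
    · simp [W, hj, hzx j hj]
  have hWan : ∀ j a, AnalyticOnNhd ℝ (fun t => W t j a) Set.univ := by
    intro j a
    by_cases hj : j ∈ Γ.unsatisfied x
    · simp only [W, hj, if_true]
      intro t _
      fun_prop
    · simp only [W, hj, if_false]
      exact analyticOnNhd_const
  have hRan : ∀ i b, AnalyticOnNhd ℝ (fun t => Γ.actionReward i b (W t)) Set.univ := by
    intro i b t ht
    unfold actionReward
    refine Finset.analyticAt_fun_sum _ fun a _ => ?_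
    refine (analyticAt_const.mul ?_).mul analyticAt_const
    exact Finset.analyticAt_fun_prod _ fun j _ => hWan j (a j) t ht
  have hev1 : ∀ i, ∀ᶠ t in 𝓝[>] (0 : ℝ), i ∈ Γ.unsatisfied x →
      ∃ b c, Γ.actionReward i b (W t) < Γ.actionReward i c (W t) := by
    intro i
    by_cases hi : i ∈ Γ.unsatisfied x
    · obtain ⟨b, c, hbc⟩ := exists_actionReward_ne_of_notMem_bestResponses hi
      -- The two rewards differ at `t = 1`, so their difference has no zeros accumulating at `0`.
      have := eventually_ne_zero_of_analyticOnNhd ((hRan i b).sub (hRan i c)) (s := 1)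
        (by simpa [hW1, sub_eq_zero] using hbc) 0
      filter_upwards [this.filter_mono (nhdsWithin_mono _ fun t (ht : 0 < t) => ht.ne')]
        with t ht _
      rcases lt_or_gt_of_ne (sub_ne_zero.mp ht) with h | h
      · exact ⟨b, c, h⟩
      · exact ⟨c, b, h⟩
    · exact Eventually.of_forall fun t h => absurd h hi
  obtain ⟨b₀, hb₀⟩ : ∃ b, ∑ c, z m c * Γ.actionReward m c (Γ.weights z) <
      Γ.actionReward m b (Γ.weights z) := by
    simpa [mem_bestResponses_iff] using hm
  have hcont : ∀ b, ContinuousAt (fun t => Γ.actionReward m b (W t)) 0 := fun b =>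
    (hRan m b 0 (Set.mem_univ _)).continuousAt
  have hev2 : ∀ᶠ t in 𝓝[>] (0 : ℝ), ∑ c, z m c * Γ.actionReward m c (W t) <
      Γ.actionReward m b₀ (W t) := by
    refine Filter.Eventually.filter_mono nhdsWithin_le_nhds ?_
    refine ContinuousAt.eventually_lt
      (tendsto_finsetSum _ fun c _ => (hcont c).const_mul (z m c)) (hcont b₀) ?_
    rw [hW0]; exact hb₀
  obtain ⟨t, ⟨ht0, ht1⟩, hU, hmt⟩ :=
    ((Filter.Eventually.and (Ioo_mem_nhdsGT (zero_lt_one' ℝ)) ((eventually_all.mpr hev1).and hev2))).exists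
  have hpos : ∀ j ∈ Γ.unsatisfied x, ∀ a, 0 < W t j a := by
    intro j hj a
    simp only [W, hj, if_true]
    have h1 : 0 ≤ z j a := (z j).2.1 a
    have h2 : 0 ≤ x j a := (x j).2.1 a
    have h3 : 0 < 1 - t := by linarith
    have h4 : 0 < Fintype.card (Γ.Action j) := Fintype.card_pos
    positivity
  have hmem : ∀ j, W t j ∈ stdSimplex ℝ (Γ.Action j) := by
    intro j
    by_cases hj : j ∈ Γ.unsatisfied x
    · refine ⟨fun a => (hpos j hj a).le, ?_⟩
      have h1 : ∑ a, z j a = 1 := (z j).2.2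
      have h2 : ∑ a, x j a = 1 := (x j).2.2
      simp only [W, hj, if_true]
      rw [Finset.sum_add_distrib, Finset.sum_add_distrib, ← Finset.mul_sum, ← Finset.mul_sum,
        ← Finset.mul_sum, h1, h2, Finset.sum_const, Finset.card_univ, nsmul_eq_mul,
        mul_inv_cancel₀ (by simp)]
      ring
    · have : W t j = z j := by funext a; simp [W, hj]
      rw [this]
      exact (z j).2
  have hWz : ∀ j ∉ Γ.unsatisfied x, (⟨W t j, hmem j⟩ : Γ.Strategy j) = z j := fun j hj =>
    Subtype.ext (funext fun a => if_neg hj)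
  refine ⟨fun j => ⟨W t j, hmem j⟩, fun j hj => ?_, Or.inr ⟨fun i hi => ?_, fun hsub => ?_⟩⟩
  · exact (hWz j (hsat j hj)).trans (hzx j (hsat j hj))
  · obtain ⟨b, c, hbc⟩ := hU i hi
    exact notMem_bestResponses_of_pos (hpos i hi) hbc
  · refine hmU (hsub ?_)
    change (⟨W t m, hmem m⟩ : Γ.Strategy m) ∉ Γ.bestResponses m _
    rw [hWz m hmU, mem_bestResponses_iff]
    exact fun h => absurd (h b₀) (not_le.mpr hmt)

/-- Each step before the last adds an unsatisfied player and the last step costs one more, hence `n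
+ 1`. -/
theorem exists_path_length_add_ncard_le (x₁ : Γ.Profile) :
    ∃ (T : ℕ) (x : ℕ → Γ.Profile),
      T + (Γ.unsatisfied x₁).ncard ≤ n + 1 ∧ Γ.IsSatisficingPath T x ∧ x 0 = x₁ ∧
      Γ.IsNashEquilibrium (x T) ∧
      ∀ t : ℕ, t + 1 < T → Γ.unsatisfied (x t) ⊂ Γ.unsatisfied (x (t + 1)) := by
  have hcard : ∀ y : Γ.Profile, (Γ.unsatisfied y).ncard ≤ n := fun y =>
    (Set.ncard_le_card _).trans_eq (Nat.card_fin n)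
  induction hd : n - (Γ.unsatisfied x₁).ncard using Nat.strong_induction_on generalizing x₁ with
  | _ k ih =>
    obtain ⟨x', hkeep, hx'⟩ := exists_step x₁
    by_cases hN' : Γ.IsNashEquilibrium x'
    · refine ⟨1, fun | 0 => x₁ | _ + 1 => x', by have := hcard x₁; omega, ?_, rfl,
        hN', fun t ht => by omega⟩
      intro t ht i hi
      obtain rfl : t = 0 := by
        have : t < 1 := by exact_mod_cast ht
        omega
      exact hkeep i hi
    have hss := hx'.resolve_left hN'
    have hlt : (Γ.unsatisfied x₁).ncard < (Γ.unsatisfied x').ncard := Set.ncard_lt_ncard hss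
    obtain ⟨T, x, hT, hpath, hx0, hNash, hgrow⟩ :=
      ih _ (by have := hcard x'; omega) x' rfl
    refine ⟨T + 1, fun | 0 => x₁ | t + 1 => x t, by omega, ?_, rfl, hNash, ?_⟩
    · rintro (_ | t) ht i hi
      · exact (congrFun hx0 i).trans (hkeep i hi)
      · refine hpath t ?_ i hi
        have : t + 1 < T + 1 := by exact_mod_cast ht
        exact_mod_cast Nat.lt_of_succ_lt_succ this
    · rintro (_ | t) ht
      · change _ ⊂ Γ.unsatisfied (x 0)
        rwa [hx0]
      · exact hgrow t (by omega)

end NormalFormGame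

theorem theorem1 {n : ℕ} (Γ : NormalFormGame.{u} n) :
    Γ.HasSatisficingPathsProperty ∧
    ∀ x₁ : Γ.Profile, ∃ (T : ℕ) (x : ℕ → Γ.Profile),
      T ≤ n ∧ Γ.IsSatisficingPath T x ∧ x 0 = x₁ ∧ Γ.IsNashEquilibrium (x T) ∧
      ∀ t : ℕ, t + 1 < T → Γ.unsatisfied (x t) ⊂ Γ.unsatisfied (x (t + 1)) := by
  have key : ∀ x₁ : Γ.Profile, ∃ (T : ℕ) (x : ℕ → Γ.Profile),
      T ≤ n ∧ Γ.IsSatisficingPath T x ∧ x 0 = x₁ ∧ Γ.IsNashEquilibrium (x T) ∧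
      ∀ t : ℕ, t + 1 < T → Γ.unsatisfied (x t) ⊂ Γ.unsatisfied (x (t + 1)) := by
    intro x₁
    -- From an equilibrium the length lemma gives only `T ≤ n + 1`, so the constant path is used;
    -- otherwise an unsatisfied player absorbs the extra `1`.
    by_cases hN : Γ.IsNashEquilibrium x₁
    · exact ⟨0, fun _ => x₁, n.zero_le, fun t ht => by simp at ht, rfl, hN, fun t ht => by omega⟩
    · obtain ⟨T, x, hT, h⟩ := NormalFormGame.exists_path_length_add_ncard_le x₁
      refine ⟨T, x, ?_, h⟩
      obtain ⟨i, hi⟩ := not_forall.mp hN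
      have : 0 < (Γ.unsatisfied x₁).ncard := (Set.ncard_pos).mpr ⟨i, hi⟩
      omega
  refine ⟨fun x₁ => ?_, key⟩
  obtain ⟨T, x, -, hpath, hx0, hNash, -⟩ := key x₁
  exact ⟨T, x, hpath, hx0, hNash⟩
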